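/- Positions are pairs $(x,y)\in\mathbb{N}^2$. The moves of Wythoff's game are the vectors $(i,0)$, $(0,i)$ and $(i,i)$ with $i>0$; a move $m$ can be played from $(x,y)$ if $(x,y)-m\in\mathbb{N}^2$, and then $(x,y)-m$ is an option of $(x,y)$. For $k\ge 1$, the blocking game $W^k$ is played by two players with these moves: before each move, the previous player (the one who is not about to move) may declare at most $k-1$ of the options of the current position forbidden for that move only; then the next player moves to an option that is not forbidden, and a player who cannot do so loses. More generally, the same game can be played with any set $M$ of moves in place of Wythoff's. A position is a $\mathcal{P}$-position if the previous player has a winning strategy from it, i.e., if the previous player can forbid at most $k-1$ of its options so that none of the remaining options is a $\mathcal{P}$-position. A move $m\in M$ is redundant if the set of $\mathcal{P}$-positions for the set of moves $M\setminus\{m\}$ is the same as for $M$ (with the same $k$). **Theorem.** Neither $W^2$ nor $W^3$ has a redundant move: for $k\in\{2,3\}$ and every Wythoff move $m$, removing $m$ from the set of moves of $W^k$ changes the set of $\mathcal{P}$-positions. -/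

import Mathlib

namespace BlockingGame

/-- The options of a position `p` of the two-pile take-away game with rule-set `M`, where the move
`m = (i, j)` removes `i` tokens from the first pile and `j` tokens from the second one.
Passing is not allowed. -/
def options (M : Set (ℕ × ℕ)) (p : ℕ × ℕ) : Set (ℕ × ℕ) :=
  {q | ∃ m ∈ M, m ≠ (0, 0) ∧ q + m = p}

theorem options_decreasing {M : Set (ℕ × ℕ)} {p q : ℕ × ℕ} (h : q ∈ options M p) :
    q.1 + q.2 < p.1 + p.2 := by
  obtain ⟨⟨i, j⟩, -, hm, rfl⟩ := h
  have : i ≠ 0 ∨ j ≠ 0 := by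
    by_contra! hc
    exact hm (by rw [hc.1, hc.2])
  simp only [Prod.fst_add, Prod.snd_add]
  omega

/-- `IsPPosition k M p`: in the game with rule-set `M` where before each move the previous player
may forbid at most `k - 1` options (`k ≥ 1`), the previous player wins from `p`: he can declare a
set `B` of at most `k - 1` options of `p` forbidden in such a way that every option still available
to the next player is an N-position (i.e. not a P-position).
A player who has no available option loses. -/
def IsPPosition (k : ℕ) (M : Set (ℕ × ℕ)) (p : ℕ × ℕ) : Prop :=
  ∃ B : Finset (ℕ × ℕ), (B : Set (ℕ × ℕ)) ⊆ options M p ∧ B.card ≤ k - 1 ∧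
    ∀ q, (_hq : q ∈ options M p) → q ∉ B → ¬ IsPPosition k M q
termination_by p.1 + p.2
decreasing_by exact options_decreasing _hq

/-- The set of P-positions of the game with rule-set `M` and at most `k - 1` blocked options. -/
def pPositions (k : ℕ) (M : Set (ℕ × ℕ)) : Set (ℕ × ℕ) :=
  {p | IsPPosition k M p}

/-- The moves of Wythoff's game: `(i, 0)`, `(0, i)` and `(i, i)` for `i > 0`. The game `W^k` is the
game with this rule-set in which at most `k - 1` options may be forbidden before each move. -/
def wythoffMoves : Set (ℕ × ℕ) :=
  {m | ∃ i : ℕ, 0 < i ∧ (m = (i, 0) ∨ m = (0, i) ∨ m = (i, i))}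

/-- A move `m` is redundant if removing it from the rule-set does not change the set of
P-positions. -/
def IsRedundantMove (k : ℕ) (M : Set (ℕ × ℕ)) (m : ℕ × ℕ) : Prop :=
  m ∈ M ∧ pPositions k (M \ {m}) = pPositions k M

end BlockingGame

namespace BlockingGame

/-! A set is the P-set exactly when its members have fewer than `k` options in it and all other
positions at least `k`. Hence `m` is not redundant once it leads from an N-position with exactly `k`
P-options to one of them: without `m` that position would become P. It remains to find the P-sets
explicitly (`pPositions_three_wythoffMoves`, `pPositions_two_wythoffMoves`) and one such critical
N-position per move.

For `k = 3` the P-set is a pair of lines of slope 2, their mirror images and the origin. For `k = 2`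
the second line gives way to Wythoff's pairs, doubled and shifted by 2; parity separates them from
the line, and Beatty complementarity puts each positive even number in exactly one pair. Only the
diagonal moves of `W^2` are delicate: gaps in the upper Wythoff sequence yield a critical position
whose row and column meet no unwanted pair. -/

theorem mem_pPositions_iff {k : ℕ} {M : Set (ℕ × ℕ)} {p : ℕ × ℕ} :
    p ∈ pPositions k M ↔
      ∃ B : Finset (ℕ × ℕ), B.card ≤ k - 1 ∧
        ∀ q ∈ options M p, q ∈ pPositions k M → q ∈ B := by
  classical
  change IsPPosition k M p ↔ _
  rw [IsPPosition]
  constructor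
  · rintro ⟨B, -, hc, h⟩
    exact ⟨B, hc, fun q hq hP => by_contra fun hB => h q hq hB hP⟩
  · rintro ⟨B, hc, h⟩
    refine ⟨B.filter (· ∈ options M p), fun q hq => ?_,
      (Finset.card_filter_le _ _).trans hc, fun q hq hB hP => ?_⟩
    · simpa using (Finset.mem_filter.1 (Finset.mem_coe.1 hq)).2
    · exact hB (Finset.mem_filter.2 ⟨h q hq hP, hq⟩)

/-- A set is the set of P-positions as soon as each of its elements has fewer than `k` options in
it, and every other position has at least `k`. -/
theorem pPositions_eq_of_forall {k : ℕ} {M A : Set (ℕ × ℕ)}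
    (hA : ∀ p ∈ A, ∃ B : Finset (ℕ × ℕ), B.card ≤ k - 1 ∧ ∀ q ∈ options M p, q ∈ A → q ∈ B)
    (hA' : ∀ p ∉ A, ∃ C : Finset (ℕ × ℕ), k - 1 < C.card ∧ ∀ q ∈ C, q ∈ options M p ∧ q ∈ A) :
    pPositions k M = A := by
  have key : ∀ n : ℕ, ∀ p : ℕ × ℕ, p.1 + p.2 = n → (p ∈ pPositions k M ↔ p ∈ A) := by
    intro n
    induction n using Nat.strong_induction_on with
    | _ n ih =>
      rintro p rfl
      have ih' : ∀ q ∈ options M p, (q ∈ pPositions k M ↔ q ∈ A) := fun q hq =>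
        ih _ (options_decreasing hq) q rfl
      rw [mem_pPositions_iff]
      constructor
      · rintro ⟨B, hc, hB⟩
        by_contra hp
        obtain ⟨C, hC, h⟩ := hA' p hp
        have : C ⊆ B := fun q hq => hB q (h q hq).1 ((ih' q (h q hq).1).2 (h q hq).2)
        have := Finset.card_le_card this
        omega
      · intro hp
        obtain ⟨B, hc, hB⟩ := hA p hp
        exact ⟨B, hc, fun q hq hP => hB q hq ((ih' q hq).1 hP)⟩
  ext p
  exact key _ p rfl

/-- A move is not redundant if it leads from an N-position with at most `k` P-options to one of
those P-options. -/
theorem not_isRedundantMove {k : ℕ} {M A : Set (ℕ × ℕ)} {m : ℕ × ℕ} (hM : pPositions k M = A)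
    (q : ℕ × ℕ) (hq : q + m ∉ A) (B : Finset (ℕ × ℕ)) (hc : B.card ≤ k - 1)
    (hB : ∀ r ∈ options M (q + m), r ∈ A → r = q ∨ r ∈ B) :
    ¬ IsRedundantMove k M m := by
  rintro ⟨-, h⟩
  rw [hM] at h
  apply hq
  rw [← h, mem_pPositions_iff, h]
  refine ⟨B, hc, ?_⟩
  rintro r ⟨l, hl, hl0, hr⟩ hrA
  -- `m` is the only move from `q + m` to `q`, and it has been removed.
  refine (hB r ⟨l, hl.1, hl0, hr⟩ hrA).resolve_left ?_
  rintro rfl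
  exact hl.2 (add_left_cancel hr)

/-! ### Wythoff's moves and their symmetry -/

theorem mem_options_wythoffMoves {x y u v : ℕ} :
    (u, v) ∈ options wythoffMoves (x, y) ↔
      (u = x ∧ v < y) ∨ (v = y ∧ u < x) ∨ (u < x ∧ u + y = v + x) := by
  constructor
  · rintro ⟨m, ⟨i, hi, rfl | rfl | rfl⟩, -, h⟩ <;>
      simp only [Prod.mk_add_mk, Prod.mk.injEq] at h <;> omega
  · rintro (⟨rfl, h⟩ | ⟨rfl, h⟩ | ⟨h, h'⟩)
    · exact ⟨(0, y - v), ⟨y - v, by omega, by simp⟩, by simp; omega, by simp; omega⟩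
    · exact ⟨(x - u, 0), ⟨x - u, by omega, by simp⟩, by simp; omega, by simp; omega⟩
    · exact ⟨(x - u, x - u), ⟨x - u, by omega, by simp⟩, by simp; omega, by simp; omega⟩

theorem swap_mem_options_wythoffMoves {p q : ℕ × ℕ} (h : q ∈ options wythoffMoves p) :
    q.swap ∈ options wythoffMoves p.swap := by
  obtain ⟨x, y⟩ := p
  obtain ⟨u, v⟩ := q
  simp only [Prod.swap_prod_mk, mem_options_wythoffMoves] at h ⊢
  omega

/-- For a symmetric set and Wythoff's moves it suffices to count P-options of the positions
`(x, y)` with `x ≤ y`. -/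
theorem pPositions_wythoffMoves_eq {k : ℕ} {A : Set (ℕ × ℕ)} (hs : ∀ p ∈ A, p.swap ∈ A)
    (hA : ∀ x y, x ≤ y → (x, y) ∈ A → ∃ B : Finset (ℕ × ℕ), B.card ≤ k - 1 ∧
      ∀ u v, (u, v) ∈ options wythoffMoves (x, y) → (u, v) ∈ A → (u, v) ∈ B)
    (hA' : ∀ x y, x ≤ y → (x, y) ∉ A → ∃ C : Finset (ℕ × ℕ), k - 1 < C.card ∧
      ∀ q ∈ C, q ∈ options wythoffMoves (x, y) ∧ q ∈ A) :
    pPositions k wythoffMoves = A := by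
  apply pPositions_eq_of_forall
  · rintro ⟨x, y⟩ hp
    rcases le_total x y with h | h
    · obtain ⟨B, hc, hB⟩ := hA x y h hp
      exact ⟨B, hc, fun q => hB q.1 q.2⟩
    · obtain ⟨B, hc, hB⟩ := hA y x h (hs _ hp)
      refine ⟨B.map (Equiv.prodComm ℕ ℕ).toEmbedding, by simpa using hc, fun q hq hqA => ?_⟩
      exact Finset.mem_map.2
        ⟨q.swap, hB q.2 q.1 (swap_mem_options_wythoffMoves hq) (hs _ hqA), by simp⟩
  · rintro ⟨x, y⟩ hp
    rcases le_total x y with h | h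
    · exact hA' x y h hp
    · obtain ⟨C, hc, hC⟩ := hA' y x h (fun h' => hp (hs _ h'))
      refine ⟨C.map (Equiv.prodComm ℕ ℕ).toEmbedding, by simpa using hc, fun q hq => ?_⟩
      obtain ⟨r, hr, rfl⟩ := Finset.mem_map.1 hq
      obtain ⟨h1, h2⟩ := hC r hr
      exact ⟨swap_mem_options_wythoffMoves h1, hs _ h2⟩

/-! ### At most two blocked options -/

/-- The P-positions of `W^3`. -/
def doubleLine : Set (ℕ × ℕ) :=
  {p | p = (0, 0) ∨ p.2 = 2 * p.1 + 1 ∨ p.2 = 2 * p.1 + 2 ∨ p.1 = 2 * p.2 + 1 ∨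
    p.1 = 2 * p.2 + 2}

theorem mem_doubleLine {x y : ℕ} : (x, y) ∈ doubleLine ↔
    (x = 0 ∧ y = 0) ∨ y = 2 * x + 1 ∨ y = 2 * x + 2 ∨ x = 2 * y + 1 ∨ x = 2 * y + 2 := by
  simp [doubleLine]

theorem pPositions_three_wythoffMoves : pPositions 3 wythoffMoves = doubleLine := by
  apply pPositions_wythoffMoves_eq
  · rintro ⟨x, y⟩ h
    simp only [Prod.swap_prod_mk, mem_doubleLine] at h ⊢
    omega
  · intro x y hxy hp
    rw [mem_doubleLine] at hp
    refine ⟨{(x, (x - 1) / 2), if y = 2 * x + 2 then (x, 2 * x + 1) else (x - 1, 2 * x)},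
      Finset.card_le_two, fun u v hq hqA => ?_⟩
    simp only [mem_doubleLine, mem_options_wythoffMoves] at hq hqA
    split_ifs with h <;>
      simp only [Finset.mem_insert, Finset.mem_singleton, Prod.mk.injEq] <;> omega
  · intro x y hxy hp
    rw [mem_doubleLine] at hp
    rcases lt_or_ge (2 * x + 2) y with h | h
    · refine ⟨{(x, (x - 1) / 2), (x, 2 * x + 1), (x, 2 * x + 2)}, ?_, ?_⟩
      · rw [Finset.card_eq_three.2 ⟨_, _, _, ?_, ?_, ?_, rfl⟩] <;> simp <;> omega
      · simp only [Finset.forall_mem_insert, Finset.mem_singleton, forall_eq, mem_doubleLine,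
          mem_options_wythoffMoves]
        simp only [true_and, true_or, or_true, and_true]
        omega
    -- One P-option each in column, row and diagonal; for `y = x`, truncation turns the last into
    -- the origin.
    · refine ⟨{(x, (x - 1) / 2), ((y - 1) / 2, y), (y - x - 1, y - x + (y - x - 1))}, ?_, ?_⟩
      · rw [Finset.card_eq_three.2 ⟨_, _, _, ?_, ?_, ?_, rfl⟩] <;> simp <;> omega
      · simp only [Finset.forall_mem_insert, Finset.mem_singleton, forall_eq, mem_doubleLine,
          mem_options_wythoffMoves]
        simp only [true_and]
        omega

theorem not_isRedundantMove_three {m : ℕ × ℕ} (hm : m ∈ wythoffMoves) :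
    ¬ IsRedundantMove 3 wythoffMoves m := by
  obtain ⟨i, hi, rfl | rfl | rfl⟩ := hm
  · refine not_isRedundantMove pPositions_three_wythoffMoves (2, 0) ?_ {(0, 0), (1, 0)}
      Finset.card_le_two ?_
    · simp only [Prod.mk_add_mk, mem_doubleLine]
      omega
    · rintro ⟨u, v⟩
      simp only [Prod.mk_add_mk, mem_doubleLine, mem_options_wythoffMoves, Finset.mem_insert,
        Finset.mem_singleton, Prod.mk.injEq]
      omega
  · refine not_isRedundantMove pPositions_three_wythoffMoves (0, 2) ?_ {(0, 0), (0, 1)}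
      Finset.card_le_two ?_
    · simp only [Prod.mk_add_mk, mem_doubleLine]
      omega
    · rintro ⟨u, v⟩
      simp only [Prod.mk_add_mk, mem_doubleLine, mem_options_wythoffMoves, Finset.mem_insert,
        Finset.mem_singleton, Prod.mk.injEq]
      omega
  -- Column, row and diagonal of `(i, i + 1)` hold one P-option each.
  · refine not_isRedundantMove pPositions_three_wythoffMoves (0, 1) ?_
      {(i, (i - 1) / 2), (i / 2, i + 1)} Finset.card_le_two ?_
    · simp only [Prod.mk_add_mk, mem_doubleLine]
      omega
    · rintro ⟨u, v⟩
      simp only [Prod.mk_add_mk, mem_doubleLine, mem_options_wythoffMoves, Finset.mem_insert,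
        Finset.mem_singleton, Prod.mk.injEq]
      omega

/-! ### The lower Wythoff sequence -/

/-- The lower Wythoff sequence `⌊n φ⌋`; the upper one is `⌊n φ⌋ + n`. -/
noncomputable def lowerWythoff (n : ℕ) : ℕ := ⌊n * Real.goldenRatio⌋₊

open Real in
theorem lowerWythoff_eq_iff {n a : ℕ} :
    lowerWythoff n = a ↔ (a : ℝ) ≤ n * goldenRatio ∧ n * goldenRatio < a + 1 :=
  Nat.floor_eq_iff (mul_nonneg n.cast_nonneg goldenRatio_pos.le)

theorem lowerWythoff_zero : lowerWythoff 0 = 0 := by simp [lowerWythoff]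

theorem lowerWythoff_one : lowerWythoff 1 = 1 := by
  rw [lowerWythoff_eq_iff]
  constructor
  · simpa using Real.one_lt_goldenRatio.le
  · have := Real.goldenRatio_lt_two
    norm_num
    linarith

theorem lowerWythoff_add_le (n m : ℕ) :
    lowerWythoff n + lowerWythoff m ≤ lowerWythoff (n + m) := by
  unfold lowerWythoff
  push_cast
  rw [add_mul]
  apply Nat.le_floor
  push_cast
  have h := Real.goldenRatio_pos
  exact add_le_add (Nat.floor_le (by positivity)) (Nat.floor_le (by positivity))

theorem three_le_lowerWythoff_two : 3 ≤ lowerWythoff 2 := by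
  apply Nat.le_floor
  have h := Real.goldenRatio_sq
  have h' := Real.goldenRatio_pos
  push_cast
  nlinarith

theorem lowerWythoff_add_one_le (n : ℕ) : lowerWythoff n + 1 ≤ lowerWythoff (n + 1) := by
  simpa only [lowerWythoff_one] using lowerWythoff_add_le n 1

/-- Makes upper members two indices apart differ by at least 5. -/
theorem lowerWythoff_add_three_le (n : ℕ) : lowerWythoff n + 3 ≤ lowerWythoff (n + 2) :=
  (Nat.add_le_add_left three_le_lowerWythoff_two _).trans (lowerWythoff_add_le n 2)

theorem lowerWythoff_strictMono : StrictMono lowerWythoff :=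
  strictMono_nat_of_lt_succ lowerWythoff_add_one_le

theorem le_lowerWythoff (n : ℕ) : n ≤ lowerWythoff n := lowerWythoff_strictMono.le_apply

/-- Strict monotonicity in a form usable by `omega`, for which the values are atoms. -/
theorem lowerWythoff_trichotomy (n m : ℕ) :
    (n < m ∧ lowerWythoff n < lowerWythoff m) ∨ (n = m ∧ lowerWythoff n = lowerWythoff m) ∨
      (m < n ∧ lowerWythoff m < lowerWythoff n) := by
  rcases lt_trichotomy n m with h | h | h
  · exact Or.inl ⟨h, lowerWythoff_strictMono h⟩
  · exact Or.inr (Or.inl ⟨h, congrArg _ h⟩)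
  · exact Or.inr (Or.inr ⟨h, lowerWythoff_strictMono h⟩)

open Real in
-- The hypothesis of Rayleigh's theorem: the Beatty sequences of `φ` and `φ + 1 = φ²` partition the
-- positive integers.
theorem holderConjugate_goldenRatio_sq : goldenRatio.HolderConjugate (goldenRatio + 1) := by
  rw [Real.holderConjugate_iff]
  refine ⟨one_lt_goldenRatio, ?_⟩
  have h := goldenRatio_pos
  have h' := goldenRatio_sq
  generalize goldenRatio = g at h h' ⊢
  field_simp
  linarith

open Real in
theorem beattySeq_goldenRatio (n : ℕ) : beattySeq goldenRatio n = lowerWythoff n := by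
  rw [beattySeq, lowerWythoff, Int.cast_natCast, Int.natCast_floor_eq_floor]
  have h := goldenRatio_pos
  positivity

open Real in
theorem beattySeq_goldenRatio_add_one (n : ℕ) :
    beattySeq (goldenRatio + 1) n = (lowerWythoff n + n : ℕ) := by
  rw [Nat.cast_add, ← beattySeq_goldenRatio, beattySeq, beattySeq, Int.cast_natCast, mul_add,
    mul_one, Int.floor_add_natCast]

open Real in
theorem lowerWythoff_ne_add {n m : ℕ} (hn : 0 < n) (hm : 0 < m) :
    lowerWythoff n ≠ lowerWythoff m + m := by
  intro h
  have hS := goldenRatio_irrational.beattySeq_symmDiff_beattySeq_pos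
    holderConjugate_goldenRatio_sq
  have h0 : ((lowerWythoff n : ℕ) : ℤ) ∈ {j : ℤ | 0 < j} := by
    have := le_lowerWythoff n
    simp only [Set.mem_ofPred_eq]
    omega
  rw [← hS, Set.mem_symmDiff] at h0
  have h1 : ((lowerWythoff n : ℕ) : ℤ) ∈ {x | ∃ k > 0, beattySeq goldenRatio k = x} :=
    ⟨n, by exact_mod_cast hn, beattySeq_goldenRatio n⟩
  have h2 : ((lowerWythoff n : ℕ) : ℤ) ∈ {x | ∃ k > 0, beattySeq (goldenRatio + 1) k = x} :=
    ⟨m, by exact_mod_cast hm, by rw [beattySeq_goldenRatio_add_one, h]⟩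
  tauto

open Real in
theorem exists_lowerWythoff_eq (x : ℕ) :
    (∃ n, x = lowerWythoff n) ∨ ∃ n, 0 < n ∧ x = lowerWythoff n + n := by
  rcases Nat.eq_zero_or_pos x with rfl | hx
  · exact Or.inl ⟨0, lowerWythoff_zero.symm⟩
  have hS := goldenRatio_irrational.beattySeq_symmDiff_beattySeq_pos
    holderConjugate_goldenRatio_sq
  have h0 : (x : ℤ) ∈ {j : ℤ | 0 < j} := Int.natCast_pos.2 hx
  rw [← hS] at h0
  rcases h0 with ⟨⟨k, hk, h⟩, -⟩ | ⟨⟨k, hk, h⟩, -⟩ <;> lift k to ℕ using hk.le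
  · rw [beattySeq_goldenRatio] at h
    exact Or.inl ⟨k, by exact_mod_cast h.symm⟩
  · rw [beattySeq_goldenRatio_add_one] at h
    exact Or.inr ⟨k, by exact_mod_cast hk, by exact_mod_cast h.symm⟩

/-! ### At most one blocked option -/

/-- The P-positions of `W^2`. -/
def lineAndDoubledWythoff : Set (ℕ × ℕ) :=
  {p | p = (0, 0) ∨ p.2 = 2 * p.1 + 1 ∨ p.1 = 2 * p.2 + 1 ∨
    (∃ n, p.1 = 2 * lowerWythoff n + 2 ∧ p.2 = p.1 + 2 * n) ∨
    ∃ n, p.2 = 2 * lowerWythoff n + 2 ∧ p.1 = p.2 + 2 * n}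

theorem mem_lineAndDoubledWythoff {x y : ℕ} : (x, y) ∈ lineAndDoubledWythoff ↔
    (x = 0 ∧ y = 0) ∨ y = 2 * x + 1 ∨ x = 2 * y + 1 ∨
    (∃ n, x = 2 * lowerWythoff n + 2 ∧ y = x + 2 * n) ∨
    ∃ n, y = 2 * lowerWythoff n + 2 ∧ x = y + 2 * n := by
  simp [lineAndDoubledWythoff]

theorem swap_mem_lineAndDoubledWythoff {p : ℕ × ℕ} (h : p ∈ lineAndDoubledWythoff) :
    p.swap ∈ lineAndDoubledWythoff := by
  obtain ⟨x, y⟩ := p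
  rw [mem_lineAndDoubledWythoff] at h
  rw [Prod.swap_prod_mk, mem_lineAndDoubledWythoff, and_comm]
  rcases h with h | h | h | h | h <;> simp only [h, true_or, or_true, and_self]

theorem lowerWythoff_ne_add' (n m : ℕ) : lowerWythoff n ≠ lowerWythoff m + m ∨ m = 0 := by
  rcases Nat.eq_zero_or_pos m with h | hm
  · exact Or.inr h
  rcases Nat.eq_zero_or_pos n with rfl | hn
  · left
    rw [lowerWythoff_zero]
    omega
  · exact Or.inl (lowerWythoff_ne_add hn hm)

/-- A positive integer is odd, or a member of a doubled and shifted Wythoff pair. -/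
theorem exists_doubled {x : ℕ} (hx : 0 < x) :
    (∃ j, x = 2 * j + 1) ∨ (∃ n, x = 2 * lowerWythoff n + 2) ∨
      ∃ n, 0 < n ∧ x = 2 * lowerWythoff n + 2 + 2 * n := by
  rcases Nat.even_or_odd' x with ⟨j, rfl | rfl⟩
  · right
    rcases exists_lowerWythoff_eq (j - 1) with ⟨n, h⟩ | ⟨n, hn, h⟩
    · exact Or.inl ⟨n, by omega⟩
    · exact Or.inr ⟨n, hn, by omega⟩
  · exact Or.inl ⟨j, rfl⟩

/-- Any two P-options of a P-position coincide. -/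
theorem exists_forall_option_eq_of_mem {x y : ℕ} (hxy : x ≤ y)
    (hp : (x, y) ∈ lineAndDoubledWythoff) :
    ∃ q : ℕ × ℕ, ∀ u v, (u, v) ∈ options wythoffMoves (x, y) →
      (u, v) ∈ lineAndDoubledWythoff → (u, v) = q := by
  rw [mem_lineAndDoubledWythoff] at hp
  simp only [mem_lineAndDoubledWythoff, mem_options_wythoffMoves, Prod.exists,
    Prod.mk.injEq]
  have h1 := le_lowerWythoff
  rcases hp with ⟨rfl, rfl⟩ | rfl | h | ⟨n, rfl, rfl⟩ | ⟨n, h, h'⟩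
  · exact ⟨0, 0, fun u v hq => (show False by omega).elim⟩
  · rcases Nat.eq_zero_or_pos x with rfl | hx
    · refine ⟨0, 0, ?_⟩
      rintro u v hq (hqA | hqA | hqA | ⟨m, hm, hm'⟩ | ⟨m, hm, hm'⟩) <;> omega
    -- The only P-option is in the column. The row is odd, and a pair on the diagonal would lie
    -- beyond `(x, 2 * x + 1)` because `n ≤ lowerWythoff n`.
    rcases exists_doubled hx with ⟨j, rfl⟩ | ⟨n, rfl⟩ | ⟨n, hn, rfl⟩
    · refine ⟨2 * j + 1, j, ?_⟩
      rintro u v hq (hqA | hqA | hqA | ⟨m, hm, hm'⟩ | ⟨m, hm, hm'⟩) <;>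
        first | omega | (have := h1 m; omega)
    · refine ⟨2 * lowerWythoff n + 2, 2 * lowerWythoff n + 2 + 2 * n, ?_⟩
      rintro u v hq (hqA | hqA | hqA | ⟨m, hm, hm'⟩ | ⟨m, hm, hm'⟩) <;>
        first
        | omega
        | (have := h1 m; have := lowerWythoff_trichotomy n m
           have := lowerWythoff_ne_add' n m; omega)
    · refine ⟨2 * lowerWythoff n + 2 + 2 * n, 2 * lowerWythoff n + 2, ?_⟩
      rintro u v hq (hqA | hqA | hqA | ⟨m, hm, hm'⟩ | ⟨m, hm, hm'⟩) <;>
        first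
        | omega
        | (have := h1 m; have := lowerWythoff_trichotomy n m
           have := lowerWythoff_ne_add' m n; omega)
  · omega
  -- The line point on the diagonal of difference `2 * n`; for `n = 0` truncation gives the origin.
  · refine ⟨2 * n - 1, 4 * n - 1, ?_⟩
    rintro u v hq (hqA | hqA | hqA | ⟨m, hm, hm'⟩ | ⟨m, hm, hm'⟩) <;>
      first
      | (have := h1 n; omega)
      | (have := h1 n; have := h1 m; have := lowerWythoff_trichotomy n m
         have := lowerWythoff_ne_add' n m; have := lowerWythoff_ne_add' m n; omega)
  · obtain rfl : n = 0 := by omega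
    refine ⟨0, 0, ?_⟩
    rw [lowerWythoff_zero] at h
    rintro u v hq (hqA | hqA | hqA | ⟨m, hm, hm'⟩ | ⟨m, hm, hm'⟩) <;> omega

theorem exists_two_options_of_notMem {x y : ℕ} (hxy : x ≤ y)
    (hp : (x, y) ∉ lineAndDoubledWythoff) :
    ∃ q r : ℕ × ℕ, q ≠ r ∧ (q ∈ options wythoffMoves (x, y) ∧ q ∈ lineAndDoubledWythoff) ∧
      r ∈ options wythoffMoves (x, y) ∧ r ∈ lineAndDoubledWythoff := by
  have mem₀ : (0, 0) ∈ lineAndDoubledWythoff := by simp [mem_lineAndDoubledWythoff]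
  have mem₁ : ∀ n, (n, 2 * n + 1) ∈ lineAndDoubledWythoff := fun n => by
    simp [mem_lineAndDoubledWythoff]
  have mem₂ : ∀ n, (2 * lowerWythoff n + 2, 2 * lowerWythoff n + 2 + 2 * n) ∈
      lineAndDoubledWythoff := fun n => by
    simp [mem_lineAndDoubledWythoff]
  have mem₁' := fun n => swap_mem_lineAndDoubledWythoff (mem₁ n)
  have mem₂' := fun n => swap_mem_lineAndDoubledWythoff (mem₂ n)
  simp only [Prod.swap_prod_mk] at mem₁' mem₂'
  have ne₁ : y ≠ 2 * x + 1 := by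
    rintro rfl
    exact hp (mem₁ _)
  rcases Nat.eq_zero_or_pos x with rfl | hx
  · have : y ≠ 0 := by
      rintro rfl
      exact hp mem₀
    refine ⟨(0, 0), (0, 1), by simp, ⟨?_, mem₀⟩, ?_, mem₁ 0⟩ <;>
      rw [mem_options_wythoffMoves] <;> omega
  rcases lt_or_gt_of_ne ne₁ with h | h
  -- The diagonal always supplies one P-option.
  · obtain ⟨u, v, hu, huv, hu', huA⟩ : ∃ u v, u < x ∧ u + y = v + x ∧
        (u = 0 ∨ v = 2 * u + 1) ∧ (u, v) ∈ lineAndDoubledWythoff := by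
      rcases Nat.eq_zero_or_pos (y - x) with h0 | h0
      · exact ⟨0, 0, hx, by omega, Or.inl rfl, mem₀⟩
      · exact ⟨y - x - 1, 2 * (y - x - 1) + 1, by omega, by omega, Or.inr rfl, mem₁ _⟩
    suffices ∃ r : ℕ × ℕ, (u, v) ≠ r ∧ r ∈ options wythoffMoves (x, y) ∧
        r ∈ lineAndDoubledWythoff by
      obtain ⟨r, hne, hr⟩ := this
      exact ⟨(u, v), r, hne, ⟨mem_options_wythoffMoves.2 (by omega), huA⟩, hr⟩
    rcases exists_doubled hx with ⟨j, rfl⟩ | hx'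
    · refine ⟨(2 * j + 1, j), ?_, ?_, mem₁' j⟩ <;>
        simp only [ne_eq, Prod.mk.injEq, true_and, mem_options_wythoffMoves] <;> omega
    rcases Nat.even_or_odd' y with ⟨l, rfl | rfl⟩
    swap
    · refine ⟨(l, 2 * l + 1), ?_, ?_, mem₁ l⟩ <;>
        simp only [ne_eq, Prod.mk.injEq, true_and, mem_options_wythoffMoves] <;> omega
    rcases hx' with ⟨m, rfl⟩ | ⟨m, hm, rfl⟩
    · obtain ⟨n, hn⟩ : ∃ n, 2 * l = 2 * lowerWythoff m + 2 + 2 * n :=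
        ⟨l - lowerWythoff m - 1, by omega⟩
      rw [hn] at hp h huv ⊢
      -- Below the pair starting at `x`, the pair of difference `2 * n` lies on the diagonal; above
      -- it, that pair lies in the column.
      rcases lowerWythoff_trichotomy n m with hnm | ⟨rfl, -⟩ | hnm
      · refine ⟨(2 * lowerWythoff n + 2, 2 * lowerWythoff n + 2 + 2 * n), ?_, ?_, mem₂ n⟩ <;>
          simp only [ne_eq, Prod.mk.injEq, mem_options_wythoffMoves] <;> omega
      · exact absurd (mem₂ n) hp
      · refine ⟨(2 * lowerWythoff m + 2, 2 * lowerWythoff m + 2 + 2 * m), ?_, ?_, mem₂ m⟩ <;>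
          simp only [ne_eq, Prod.mk.injEq, true_and, mem_options_wythoffMoves] <;> omega
    · refine ⟨(2 * lowerWythoff m + 2 + 2 * m, 2 * lowerWythoff m + 2), ?_, ?_, mem₂' m⟩ <;>
        simp only [ne_eq, Prod.mk.injEq, true_and, mem_options_wythoffMoves] <;> omega
  · refine ⟨(x, 2 * x + 1), ?_⟩
    suffices ∃ r : ℕ, r < 2 * x + 1 ∧ (x, r) ∈ lineAndDoubledWythoff by
      obtain ⟨r, hr, hrA⟩ := this
      refine ⟨(x, r), ?_, ⟨?_, mem₁ x⟩, ?_, hrA⟩ <;>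
        simp only [ne_eq, Prod.mk.injEq, true_and, mem_options_wythoffMoves] <;> omega
    rcases exists_doubled hx with ⟨j, rfl⟩ | ⟨m, rfl⟩ | ⟨m, hm, rfl⟩
    · exact ⟨j, by omega, mem₁' j⟩
    · exact ⟨_, by have := le_lowerWythoff m; omega, mem₂ m⟩
    · exact ⟨_, by omega, mem₂' m⟩

theorem pPositions_two_wythoffMoves : pPositions 2 wythoffMoves = lineAndDoubledWythoff := by
  apply pPositions_wythoffMoves_eq
  · exact fun p => swap_mem_lineAndDoubledWythoff
  · intro x y hxy hp
    obtain ⟨q, hq⟩ := exists_forall_option_eq_of_mem hxy hp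
    exact ⟨{q}, by simp, fun u v h h' => Finset.mem_singleton.2 (hq u v h h')⟩
  · intro x y hxy hp
    obtain ⟨q, r, hne, hq, hr⟩ := exists_two_options_of_notMem hxy hp
    exact ⟨{q, r}, by simp [Finset.card_pair hne], by simp [hq, hr]⟩

/-- Some lower Wythoff number is at least `j` and has the parity of `j`. -/
theorem exists_add_two_mul_eq_lowerWythoff (j : ℕ) :
    ∃ e n, j + 2 * e = lowerWythoff n := by
  by_contra! h
  have h' : ∀ e, ∃ n, 0 < n ∧ j + 2 * e = lowerWythoff n + n := fun e =>
    (exists_lowerWythoff_eq (j + 2 * e)).resolve_left fun ⟨n, hn⟩ => h e n hn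
  obtain ⟨n₀, -, h₀⟩ := h' 0
  obtain ⟨n₁, -, h₁⟩ := h' 1
  obtain ⟨n₂, -, h₂⟩ := h' 2
  have h01 : n₀ < n₁ := by
    have := lowerWythoff_trichotomy n₀ n₁
    omega
  have h12 : n₁ < n₂ := by
    have := lowerWythoff_trichotomy n₁ n₂
    omega
  -- Two successive gaps of the upper sequence total at least 5, but `j` and `j + 4` differ by 4.
  have := lowerWythoff_add_three_le n₀
  have := lowerWythoff_strictMono.monotone (show n₀ + 2 ≤ n₂ by omega)
  omega

/-- The diagonal move `(i, i)` changes the status of `(u + i, 2 * u + 1 + i)`, provided that row and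
column contain a single P-option altogether. -/
theorem not_isRedundantMove_two_diag {i u : ℕ} (hu : Even u) (hi : 0 < i) (q : ℕ × ℕ)
    (h : ∀ v w, (v = u + i ∧ w < 2 * u + 1 + i) ∨ (w = 2 * u + 1 + i ∧ v < u + i) →
      (v, w) ∈ lineAndDoubledWythoff → (v, w) = q) :
    ¬ IsRedundantMove 2 wythoffMoves (i, i) := by
  obtain ⟨e, rfl⟩ := hu
  refine not_isRedundantMove pPositions_two_wythoffMoves (e + e, 2 * (e + e) + 1) ?_ {q} (by simp)
    ?_
  · rw [Prod.mk_add_mk, mem_lineAndDoubledWythoff]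
    rintro (h | h | h | ⟨n, -, h⟩ | ⟨n, -, h⟩) <;> omega
  · rintro ⟨v, w⟩ hr hA
    rw [Finset.mem_singleton]
    rw [Prod.mk_add_mk, mem_options_wythoffMoves] at hr
    rcases hr with hr | hr | hr
    · exact Or.inr (h v w (Or.inl hr) hA)
    · exact Or.inr (h v w (Or.inr hr) hA)
    -- This diagonal has odd difference, so it contains no pair, and it meets the line only once.
    · left
      rw [mem_lineAndDoubledWythoff] at hA
      rw [Prod.mk.injEq]
      rcases hA with h | h | h | ⟨n, -, h⟩ | ⟨n, -, h⟩ <;> omega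

theorem not_isRedundantMove_two {m : ℕ × ℕ} (hm : m ∈ wythoffMoves) :
    ¬ IsRedundantMove 2 wythoffMoves m := by
  obtain ⟨i, hi, rfl | rfl | rfl⟩ := hm
  · refine not_isRedundantMove pPositions_two_wythoffMoves (1, 0) ?_ {(0, 0)} (by simp) ?_
    · rw [Prod.mk_add_mk, mem_lineAndDoubledWythoff]
      rintro (h | h | h | ⟨n, h, h'⟩ | ⟨n, h, h'⟩) <;> omega
    · rintro ⟨u, v⟩ hr hA
      rw [Prod.mk_add_mk, mem_options_wythoffMoves] at hr
      rw [mem_lineAndDoubledWythoff] at hA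
      rw [Finset.mem_singleton, Prod.mk.injEq, Prod.mk.injEq]
      rcases hA with h | h | h | ⟨n, h, h'⟩ | ⟨n, h, h'⟩ <;> omega
  · refine not_isRedundantMove pPositions_two_wythoffMoves (0, 1) ?_ {(0, 0)} (by simp) ?_
    · rw [Prod.mk_add_mk, mem_lineAndDoubledWythoff]
      rintro (h | h | h | ⟨n, h, h'⟩ | ⟨n, h, h'⟩) <;> omega
    · rintro ⟨u, v⟩ hr hA
      rw [Prod.mk_add_mk, mem_options_wythoffMoves] at hr
      rw [mem_lineAndDoubledWythoff] at hA
      rw [Finset.mem_singleton, Prod.mk.injEq, Prod.mk.injEq]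
      rcases hA with h | h | h | ⟨n, h, h'⟩ | ⟨n, h, h'⟩ <;> omega
  rcases Nat.even_or_odd' i with ⟨j, rfl | rfl⟩
  · rcases (show j = 1 ∨ 2 ≤ j by omega) with rfl | hj
    · have h0 := lowerWythoff_zero
      have h1 := lowerWythoff_one
      refine not_isRedundantMove pPositions_two_wythoffMoves (2, 2) ?_ {(0, 0)} (by simp) ?_
      · rw [Prod.mk_add_mk, mem_lineAndDoubledWythoff]
        rintro (h | h | h | ⟨n, h, h'⟩ | ⟨n, h, h'⟩) <;>
          first
          | omega
          | (obtain rfl : n = 0 := by omega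
             omega)
      · rintro ⟨u, v⟩ hr hA
        rw [Prod.mk_add_mk, mem_options_wythoffMoves] at hr
        rw [mem_lineAndDoubledWythoff] at hA
        rw [Finset.mem_singleton, Prod.mk.injEq, Prod.mk.injEq]
        rcases hA with h | h | h | ⟨n, h, h'⟩ | ⟨n, h, h'⟩ <;>
          first
          | omega
          | (have := lowerWythoff_trichotomy n 1
             have := lowerWythoff_trichotomy n 0
             omega)
    -- The column becomes `2 * lowerWythoff n + 2`; by `e < n` its pair lies too high to be an
    -- option. The odd row holds only its line point.
    obtain ⟨e, n, hen, hn⟩ : ∃ e n, e < n ∧ lowerWythoff n + 1 = j + e := by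
      rcases exists_lowerWythoff_eq (j - 1) with ⟨n, h⟩ | ⟨m, hm, h⟩
      · refine ⟨0, n, Nat.pos_of_ne_zero ?_, by omega⟩
        rintro rfl
        rw [lowerWythoff_zero] at h
        omega
      -- Upper members are never consecutive, so `j` is lower when `j - 1` is upper.
      rcases exists_lowerWythoff_eq j with ⟨n, h'⟩ | ⟨n, hn, h'⟩
      · refine ⟨1, n, ?_, by omega⟩
        have := lowerWythoff_trichotomy n 1
        have := lowerWythoff_one
        have := le_lowerWythoff m
        omega
      · have := lowerWythoff_trichotomy n m
        omega
    refine not_isRedundantMove_two_diag (even_two_mul e) hi (2 * e + j, 2 * (2 * e + j) + 1) ?_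
    intro v w hr hA
    rw [mem_lineAndDoubledWythoff] at hA
    rw [Prod.mk.injEq]
    rcases hA with h | h | h | ⟨m, h, h'⟩ | ⟨m, h, h'⟩ <;>
      first
      | omega
      | (have := lowerWythoff_trichotomy n m
         have := lowerWythoff_ne_add' n m
         omega)
  -- The row becomes `2 * lowerWythoff n + 2` and has no P-option; the odd column holds only its
  -- point on the mirrored line.
  · obtain ⟨e, n, hn⟩ := exists_add_two_mul_eq_lowerWythoff j
    refine not_isRedundantMove_two_diag (even_two_mul e) hi (2 * (e + j) + 1, e + j) ?_
    intro v w hr hA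
    rw [mem_lineAndDoubledWythoff] at hA
    rw [Prod.mk.injEq]
    rcases hA with h | h | h | ⟨m, h, h'⟩ | ⟨m, h, h'⟩ <;>
      first
      | omega
      | (have := lowerWythoff_trichotomy n m
         have := lowerWythoff_ne_add' n m
         omega)

end BlockingGame

theorem mainTheorem11 :
    (∀ m ∈ BlockingGame.wythoffMoves,
      ¬ BlockingGame.IsRedundantMove 2 BlockingGame.wythoffMoves m) ∧
    (∀ m ∈ BlockingGame.wythoffMoves,
      ¬ BlockingGame.IsRedundantMove 3 BlockingGame.wythoffMoves m) :=
  ⟨fun _ => BlockingGame.not_isRedundantMove_two, fun _ => BlockingGame.not_isRedundantMove_three⟩
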